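/- All graphs are connected, simple and non-empty (possibly infinite, not necessarily locally finite), and are regarded as metric graphs whose edges have length $1$, with the path metric. A geodesic metric space is hyperbolic if there is $\delta\ge 0$ such that, for every geodesic triangle, each side is contained in the $\delta$-neighborhood of the union of the other two sides. The direct product $G_1\times G_2$ has vertex set $V(G_1)\times V(G_2)$, with $(u_1,v_1)$ and $(u_2,v_2)$ adjacent if and only if $[u_1,u_2]\in E(G_1)$ and $[v_1,v_2]\in E(G_2)$. A cycle is a simple closed path. A $u,v$-walk $g$ is a shortcut of a cycle $C$ if $g\cap C=\{u,v\}$ and its length satisfies $L(g)<d_C(u,v)$, where $d_C$ is the length metric of $C$. A cycle $C'$ is a reduction of a cycle $C$ if both have odd length and $C'$ is the union of a subarc of $C$ and a shortcut of $C$ joining the endpoints of that subarc. A cycle is minimal if it has odd length and has no reduction. Let $\mathfrak C(G)$ denote the set of minimal cycles of $G$; distances to $\mathfrak C(G)$ are distances to the union of these cycles. Theorem. Let $G_1$ be a graph with some odd cycle, and let $G_2$ be a graph with more than one vertex, of finite diameter and without odd cycles. Assume that for each $M>0$ there exist a geodesic $g$ in $G_1$ joining (a point of) a minimal cycle of $G_1$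 to (a point of) a minimal cycle of $G_1$, the two cycles not being required to be distinct, and a vertex $u\in g\cap V(G_1)$ with $$d_{G_1}\big(u,\mathfrak C(G_1)\big)\ge M .$$ Then $G_1\times G_2$ is not hyperbolic. -/

import Mathlib

open scoped ENNReal NNReal

namespace DirectProductHyperbolicity

/-! ### The direct product of graphs -/

/-- The direct (tensor, categorical) product of two simple graphs: `(u₁, v₁)` and `(u₂, v₂)` are
adjacent iff `u₁, u₂` are adjacent in the first factor and `v₁, v₂` in the second. -/
def directProduct {V W : Type*} (G : SimpleGraph V) (H : SimpleGraph W) :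
    SimpleGraph (V × W) where
  Adj p q := G.Adj p.1 q.1 ∧ H.Adj p.2 q.2
  symm := ⟨fun _ _ h => ⟨h.1.symm, h.2.symm⟩⟩
  loopless := ⟨fun p h => G.loopless.irrefl p.1 h.1⟩

/-! ### A graph as a metric space with edges of length one

A point of the metric graph is given by its barycentric coordinates: the vertex `u` is the
indicator function of `u`, and the edge joining `u` and `v` is the segment between the two
vertices, identified with `[0, 1]`. -/

section Realization

variable {V : Type*}

/-- The barycentric coordinates of the vertex `u`. -/
noncomputable def vertexCoord (u : V) : V → ℝ := Set.indicator {u} 1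

/-- The closed segment between the vertices `u` and `v` (a single point if `u = v`). -/
def closedEdge (u v : V) : Set (V → ℝ) := segment ℝ (vertexCoord u) (vertexCoord v)

/-- The metric graph of `G`: its points are the vertices and the points on the edges. -/
@[ext]
structure Realization (G : SimpleGraph V) where
  /-- the barycentric coordinates of the point -/
  coord : V → ℝ
  mem_closedEdge : ∃ u v, (u = v ∨ G.Adj u v) ∧ coord ∈ closedEdge u v

namespace Realization

variable {G : SimpleGraph V}

/-- The vertex `u` as a point of the metric graph. -/
noncomputable def vertex (G : SimpleGraph V) (u : V) : Realization G :=
  ⟨vertexCoord u, u, u, Or.inl rfl, left_mem_segment ℝ _ _⟩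

/-- The part of the metric graph of `G` that belongs to the subgraph `C`. -/
def ofSubgraph (C : G.Subgraph) : Set (Realization G) :=
  {x | ∃ u ∈ C.verts, ∃ v ∈ C.verts, (u = v ∨ C.Adj u v) ∧ x.coord ∈ closedEdge u v}

/-- Distance of two points along a common closed edge (`∞` if there is no such edge). -/
noncomputable def edgeDist (x y : Realization G) : ℝ≥0∞ :=
  ⨅ (u : V) (v : V) (_ : (u = v ∨ G.Adj u v) ∧ x.coord ∈ closedEdge u v ∧
    y.coord ∈ closedEdge u v), ENNReal.ofReal |x.coord u - y.coord u|

/-- Length of a shortest path from `x` to `y` through vertices: go from `x` along its edge to an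
endpoint `u`, then to an endpoint `v` of the edge of `y`, then to `y`. If `coord u ≠ 0`, then
`1 - coord u` is the distance to `u` along the edge. It is `∞` in different components. -/
noncomputable def vertexDist (x y : Realization G) : ℝ≥0∞ :=
  ⨅ (u : V) (v : V) (_ : x.coord u ≠ 0 ∧ y.coord v ≠ 0),
    ENNReal.ofReal (1 - x.coord u) + (G.edist u v : ℝ≥0∞) + ENNReal.ofReal (1 - y.coord v)

/-- The length of a shortest path in the metric graph. -/
noncomputable instance : EDist (Realization G) := ⟨fun x y => min (edgeDist x y) (vertexDist x y)⟩

theorem edist_def (x y : Realization G) : edist x y = min (edgeDist x y) (vertexDist x y) := rfl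

end Realization

theorem closedEdge_comm (u v : V) : closedEdge u v = closedEdge v u := segment_symm _ _ _

theorem vertexCoord_self (u : V) : vertexCoord u u = 1 := by simp [vertexCoord]

theorem vertexCoord_of_ne {u w : V} (h : w ≠ u) : vertexCoord u w = 0 := by simp [vertexCoord, h]

/-- The coordinates of a point on a closed edge. -/
theorem coord_of_mem_closedEdge {u v : V} {x : V → ℝ} (h : x ∈ closedEdge u v) :
    (∀ w, 0 ≤ x w) ∧ (∀ w, x w ≤ 1) ∧ (∀ w, w ≠ u → w ≠ v → x w = 0) ∧
      (u ≠ v → x u + x v = 1) ∧ (u = v → x u = 1) := by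
  obtain ⟨a, b, ha, hb, hab, rfl⟩ := h
  refine ⟨fun w => ?_, fun w => ?_, fun w h1 h2 => ?_, fun huv => ?_, fun huv => ?_⟩
  · by_cases h1 : w = u <;> by_cases h2 : w = v <;>
      simp [vertexCoord, h1, h2, Set.indicator] <;> split_ifs <;> linarith
  · by_cases h1 : w = u <;> by_cases h2 : w = v <;>
      simp [vertexCoord, h1, h2, Set.indicator] <;> split_ifs <;> linarith
  · simp [vertexCoord_of_ne h1, vertexCoord_of_ne h2]
  · simp [vertexCoord_self, vertexCoord_of_ne huv, vertexCoord_of_ne huv.symm, hab]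
  · subst huv
    simp [vertexCoord_self, hab]

namespace Realization

variable {G : SimpleGraph V}

theorem coord_nonneg (x : Realization G) (w : V) : 0 ≤ x.coord w := by
  obtain ⟨u, v, -, h⟩ := x.mem_closedEdge
  exact (coord_of_mem_closedEdge h).1 w

theorem coord_le_one (x : Realization G) (w : V) : x.coord w ≤ 1 := by
  obtain ⟨u, v, -, h⟩ := x.mem_closedEdge
  exact (coord_of_mem_closedEdge h).2.1 w

/-- Two distinct vertices in the support of a point are the endpoints of its edge. -/
theorem coord_add_of_ne (x : Realization G) {a b : V} (hab : a ≠ b) (ha : x.coord a ≠ 0)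
    (hb : x.coord b ≠ 0) : x.coord a + x.coord b = 1 ∧ G.Adj a b := by
  obtain ⟨u, v, huv, h⟩ := x.mem_closedEdge
  obtain ⟨-, -, h3, h4, -⟩ := coord_of_mem_closedEdge h
  have ha' : a = u ∨ a = v := by
    by_contra! hc; exact ha (h3 a hc.1 hc.2)
  have hb' : b = u ∨ b = v := by
    by_contra! hc; exact hb (h3 b hc.1 hc.2)
  rcases ha' with rfl | rfl <;> rcases hb' with rfl | rfl
  · exact absurd rfl hab
  · exact ⟨h4 hab, huv.resolve_left hab⟩
  · exact ⟨by rw [add_comm]; exact h4 hab.symm, (huv.resolve_left hab.symm).symm⟩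
  · exact absurd rfl hab

theorem exists_coord_ne_zero (x : Realization G) : ∃ u, x.coord u ≠ 0 := by
  obtain ⟨u, v, -, h⟩ := x.mem_closedEdge
  obtain ⟨-, -, -, h4, h5⟩ := coord_of_mem_closedEdge h
  by_cases huv : u = v
  · exact ⟨u, by rw [h5 huv]; exact one_ne_zero⟩
  · by_contra! hc
    have := h4 huv
    rw [hc u, hc v] at this
    norm_num at this

theorem edgeDist_comm (x y : Realization G) : edgeDist x y = edgeDist y x := by
  unfold edgeDist
  refine iInf_congr fun u => iInf_congr fun v => ?_
  rw [abs_sub_comm]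
  exact iInf_congr_Prop (by tauto) fun _ => rfl

theorem vertexDist_comm (x y : Realization G) : vertexDist x y = vertexDist y x := by
  unfold vertexDist
  rw [iInf_comm]
  refine iInf_congr fun v => iInf_congr fun u => ?_
  refine iInf_congr_Prop (by tauto) fun _ => ?_
  rw [SimpleGraph.edist_comm]
  ring

/-- On a common closed edge all coordinates differ by at most the distance along the edge. -/
theorem abs_coord_sub_le {u v : V} {x y : V → ℝ} (hx : x ∈ closedEdge u v)
    (hy : y ∈ closedEdge u v) (w : V) : |x w - y w| ≤ |x u - y u| := by
  obtain ⟨-, -, h3, h4, h5⟩ := coord_of_mem_closedEdge hx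
  obtain ⟨-, -, h3', h4', h5'⟩ := coord_of_mem_closedEdge hy
  by_cases hu : w = u
  · rw [hu]
  by_cases hv : w = v
  · subst hv
    have e1 := h4 (Ne.symm hu)
    have e2 := h4' (Ne.symm hu)
    rw [show x w - y w = -(x u - y u) by linarith, abs_neg]
  · rw [h3 w hu hv, h3' w hu hv]
    simp

theorem abs_coord_le_edist (x y : Realization G) (w : V) :
    ENNReal.ofReal |x.coord w - y.coord w| ≤ edist x y := by
  rw [edist_def]
  refine le_min ?_ ?_
  · refine le_iInf fun u => le_iInf fun v => le_iInf fun h => ?_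
    exact ENNReal.ofReal_le_ofReal (abs_coord_sub_le h.2.1 h.2.2 w)
  · refine le_iInf fun u => le_iInf fun v => le_iInf fun h => ?_
    have hx0 := x.coord_nonneg w
    have hx1 := x.coord_le_one w
    have hy0 := y.coord_nonneg w
    have hy1 := y.coord_le_one w
    by_cases huv : u = v
    · subst huv
      rw [SimpleGraph.edist_self]
      have hu := x.coord_le_one u
      have hv := y.coord_le_one u
      simp only [ENat.toENNReal_zero, add_zero]
      rw [← ENNReal.ofReal_add (by linarith) (by linarith)]
      apply ENNReal.ofReal_le_ofReal
      by_cases hw : w = u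
      · subst hw
        rw [abs_le]; constructor <;> linarith
      · have e1 : x.coord w ≤ 1 - x.coord u := by
          by_cases h0 : x.coord w = 0
          · linarith
          · linarith [(x.coord_add_of_ne hw h0 h.1).1]
        have e2 : y.coord w ≤ 1 - y.coord u := by
          by_cases h0 : y.coord w = 0
          · linarith
          · linarith [(y.coord_add_of_ne hw h0 h.2).1]
        rw [abs_le]; constructor <;> linarith
    · have h1 : (1 : ℝ≥0∞) ≤ (G.edist u v : ℝ≥0∞) := by
        have : (1 : ℕ∞) ≤ G.edist u v := by
          rw [Order.one_le_iff_ne_zero]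
          exact SimpleGraph.edist_eq_zero_iff.not.mpr huv
        exact_mod_cast this
      calc ENNReal.ofReal |x.coord w - y.coord w| ≤ 1 := by
            rw [ENNReal.ofReal_le_one, abs_le]; constructor <;> linarith
        _ ≤ _ := h1.trans (le_add_right le_add_self)

theorem edist_self' (x : Realization G) : edist x x = 0 := by
  rw [edist_def]
  refine le_antisymm (min_le_of_left_le ?_) bot_le
  obtain ⟨u, v, huv, h⟩ := x.mem_closedEdge
  exact iInf_le_of_le u (iInf_le_of_le v (iInf_le_of_le ⟨huv, h, h⟩ (by simp)))

theorem edist_comm' (x y : Realization G) : edist x y = edist y x := by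
  rw [edist_def, edist_def, edgeDist_comm, vertexDist_comm]

/-- Two vertices in the support of a point are joined by a path through this point. -/
theorem edist_le_of_coord_ne_zero (y : Realization G) {v v' : V} (hv : y.coord v ≠ 0)
    (hv' : y.coord v' ≠ 0) : (G.edist v v' : ℝ≥0∞) ≤
      ENNReal.ofReal (1 - y.coord v) + ENNReal.ofReal (1 - y.coord v') := by
  by_cases h : v = v'
  · subst h; simp
  · obtain ⟨h1, h2⟩ := y.coord_add_of_ne h hv hv'
    rw [SimpleGraph.edist_eq_one_iff_adj.mpr h2, ← ENNReal.ofReal_add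
      (by linarith [y.coord_le_one v]) (by linarith [y.coord_le_one v'])]
    rw [show 1 - y.coord v + (1 - y.coord v') = 1 by linarith]
    simp

theorem vertexDist_triangle (x y z : Realization G) :
    vertexDist x z ≤ vertexDist x y + vertexDist y z := by
  unfold vertexDist
  simp only [ENNReal.iInf_add, ENNReal.add_iInf]
  refine le_iInf fun v' => le_iInf fun w => le_iInf fun hw => le_iInf fun u => le_iInf fun v =>
    le_iInf fun hu => ?_
  refine iInf_le_of_le u (iInf_le_of_le w (iInf_le_of_le ⟨hu.1, hw.2⟩ ?_))
  have h1 : (G.edist u w : ℝ≥0∞) ≤ G.edist u v + G.edist v v' + G.edist v' w := by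
    have : G.edist u w ≤ G.edist u v + G.edist v v' + G.edist v' w :=
      SimpleGraph.edist_triangle.trans (by gcongr; exact SimpleGraph.edist_triangle)
    exact_mod_cast this
  have h2 := y.edist_le_of_coord_ne_zero hu.2 hw.1
  calc _ ≤ ENNReal.ofReal (1 - x.coord u) + ((G.edist u v : ℝ≥0∞) +
        (ENNReal.ofReal (1 - y.coord v) + ENNReal.ofReal (1 - y.coord v')) +
        (G.edist v' w : ℝ≥0∞)) + ENNReal.ofReal (1 - z.coord w) := by
          gcongr
          exact h1.trans (by gcongr)
    _ = _ := by ring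

theorem vertexDist_le_edgeDist_add (x y z : Realization G) :
    vertexDist x z ≤ edgeDist x y + vertexDist y z := by
  unfold edgeDist
  simp only [ENNReal.iInf_add]
  refine le_iInf fun a => le_iInf fun b => le_iInf fun h => ?_
  unfold vertexDist
  simp only [ENNReal.add_iInf]
  refine le_iInf fun v => le_iInf fun w => le_iInf fun hv => ?_
  by_cases hxv : x.coord v = 0
  · obtain ⟨u, hu⟩ := x.exists_coord_ne_zero
    refine iInf_le_of_le u (iInf_le_of_le w (iInf_le_of_le ⟨hu, hv.2⟩ ?_))
    obtain ⟨-, -, h3, h4, h5⟩ := coord_of_mem_closedEdge h.2.1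
    obtain ⟨-, -, h3', h4', h5'⟩ := coord_of_mem_closedEdge h.2.2
    have huv : u ≠ v := fun e => hu (e ▸ hxv)
    have hu' : u = a ∨ u = b := by
      by_contra! hc; exact hu (h3 u hc.1 hc.2)
    have hv' : v = a ∨ v = b := by
      by_contra! hc; exact hv.1 (h3' v hc.1 hc.2)
    have key : x.coord u = 1 ∧ G.Adj u v := by
      rcases hu' with rfl | rfl <;> rcases hv' with rfl | rfl
      · exact absurd rfl huv
      · exact ⟨by linarith [h4 huv], h.1.resolve_left huv⟩
      · exact ⟨by linarith [h4 huv.symm], (h.1.resolve_left huv.symm).symm⟩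
      · exact absurd rfl huv
    have h1 : (G.edist u w : ℝ≥0∞) ≤ 1 + G.edist v w := by
      have : G.edist u w ≤ G.edist u v + G.edist v w := SimpleGraph.edist_triangle
      rw [SimpleGraph.edist_eq_one_iff_adj.mpr key.2] at this
      exact_mod_cast this
    have h2 : (1 : ℝ≥0∞) ≤ ENNReal.ofReal |x.coord a - y.coord a| +
        ENNReal.ofReal (1 - y.coord v) := by
      have := abs_coord_sub_le h.2.1 h.2.2 v
      rw [hxv, zero_sub, abs_neg, abs_of_nonneg (y.coord_nonneg v)] at this
      rw [← ENNReal.ofReal_add (abs_nonneg _) (by linarith [y.coord_le_one v]),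
        ENNReal.one_le_ofReal]
      linarith
    calc _ ≤ 0 + (1 + (G.edist v w : ℝ≥0∞)) + ENNReal.ofReal (1 - z.coord w) := by
          gcongr
          simp [key.1]
      _ ≤ 0 + ((ENNReal.ofReal |x.coord a - y.coord a| +
        ENNReal.ofReal (1 - y.coord v)) + (G.edist v w : ℝ≥0∞)) +
          ENNReal.ofReal (1 - z.coord w) := by gcongr
      _ = _ := by ring
  · refine iInf_le_of_le v (iInf_le_of_le w (iInf_le_of_le ⟨hxv, hv.2⟩ ?_))
    have h2 : ENNReal.ofReal (1 - x.coord v) ≤ ENNReal.ofReal |x.coord a - y.coord a| +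
        ENNReal.ofReal (1 - y.coord v) := by
      have := abs_coord_sub_le h.2.1 h.2.2 v
      rw [← ENNReal.ofReal_add (abs_nonneg _) (by linarith [y.coord_le_one v])]
      apply ENNReal.ofReal_le_ofReal
      linarith [neg_abs_le (x.coord v - y.coord v)]
    calc _ ≤ (ENNReal.ofReal |x.coord a - y.coord a| + ENNReal.ofReal (1 - y.coord v)) +
          (G.edist v w : ℝ≥0∞) + ENNReal.ofReal (1 - z.coord w) := by gcongr
      _ = _ := by ring

/-- If two pairs of points lie on common closed edges, then the triangle inequality holds, since
either the two edges coincide or the middle point is a vertex. -/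
theorem edist_le_edgeDist_add_edgeDist (x y z : Realization G) :
    edist x z ≤ edgeDist x y + edgeDist y z := by
  rw [edist_def]
  by_cases hy : ∃ v, y.coord v = 1
  · obtain ⟨v, hv⟩ := hy
    have hyy : vertexDist y y = 0 := by
      refine le_antisymm ?_ bot_le
      refine iInf_le_of_le v (iInf_le_of_le v (iInf_le_of_le ⟨?_, ?_⟩ ?_)) <;> simp [hv]
    have h1 : vertexDist x y ≤ edgeDist x y := by
      simpa [hyy] using vertexDist_le_edgeDist_add x y y
    have h2 : vertexDist y z ≤ edgeDist y z := by
      rw [vertexDist_comm, edgeDist_comm]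
      simpa [hyy] using vertexDist_le_edgeDist_add z y y
    exact (min_le_right _ _).trans ((vertexDist_triangle x y z).trans (add_le_add h1 h2))
  · refine (min_le_left _ _).trans ?_
    unfold edgeDist
    simp only [ENNReal.iInf_add, ENNReal.add_iInf]
    refine le_iInf fun c => le_iInf fun d => le_iInf fun h' => le_iInf fun a => le_iInf fun b =>
      le_iInf fun h => ?_
    have hends : ∀ p q : V, y.coord ∈ closedEdge p q → p ≠ q ∧ y.coord p ≠ 0 ∧ y.coord q ≠ 0 := by
      intro p q hpq
      obtain ⟨-, -, -, h4, h5⟩ := coord_of_mem_closedEdge hpq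
      have hne : p ≠ q := fun e => hy ⟨p, h5 e⟩
      refine ⟨hne, fun e => hy ⟨q, ?_⟩, fun e => hy ⟨p, ?_⟩⟩ <;> linarith [h4 hne]
    obtain ⟨hab, ha, hb⟩ := hends a b h.2.2
    obtain ⟨hcd, hc, hd⟩ := hends c d h'.2.1
    obtain ⟨-, -, h3, -, -⟩ := coord_of_mem_closedEdge h.2.2
    have hc' : c = a ∨ c = b := by
      by_contra! hh; exact hc (h3 c hh.1 hh.2)
    have hd' : d = a ∨ d = b := by
      by_contra! hh; exact hd (h3 d hh.1 hh.2)
    have hz : z.coord ∈ closedEdge a b := by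
      rcases hc' with rfl | rfl <;> rcases hd' with rfl | rfl
      · exact absurd rfl hcd
      · exact h'.2.2
      · rw [closedEdge_comm]; exact h'.2.2
      · exact absurd rfl hcd
    refine iInf_le_of_le a (iInf_le_of_le b (iInf_le_of_le ⟨h.1, h.2.1, hz⟩ ?_))
    rw [← ENNReal.ofReal_add (abs_nonneg _) (abs_nonneg _)]
    apply ENNReal.ofReal_le_ofReal
    exact (abs_sub_le _ (y.coord a) _).trans
      (add_le_add le_rfl (abs_coord_sub_le h'.2.1 h'.2.2 a))

theorem edist_triangle' (x y z : Realization G) : edist x z ≤ edist x y + edist y z := by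
  rw [edist_def x y, edist_def y z]
  rcases min_choice (edgeDist x y) (vertexDist x y) with h | h <;>
    rcases min_choice (edgeDist y z) (vertexDist y z) with h' | h' <;> rw [h, h']
  · exact edist_le_edgeDist_add_edgeDist x y z
  · exact (min_le_right _ _).trans (vertexDist_le_edgeDist_add x y z)
  · refine (min_le_right _ _).trans ?_
    rw [vertexDist_comm x z, vertexDist_comm x y, edgeDist_comm y z, add_comm]
    exact vertexDist_le_edgeDist_add z y x
  · exact (min_le_right _ _).trans (vertexDist_triangle x y z)

/-- The metric graph, with the path metric (infinite between different components). -/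
noncomputable instance : EMetricSpace (Realization G) where
  edist_self := edist_self'
  edist_comm := edist_comm'
  edist_triangle := edist_triangle'
  eq_of_edist_eq_zero := by
    intro x y h
    ext w
    have h1 := abs_coord_le_edist x y w
    rw [h, nonpos_iff_eq_zero, ENNReal.ofReal_eq_zero] at h1
    exact sub_eq_zero.mp (abs_nonpos_iff.mp h1)

end Realization

end Realization

/-! ### Geodesics and Gromov hyperbolicity -/

section Hyperbolic

variable {X : Type*} [EMetricSpace X]

/-- `S` is (the image of) a geodesic from `x` to `y`, parametrized by arc length. -/
def IsGeodesic (S : Set X) (x y : X) : Prop :=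
  ∃ (L : ℝ) (γ : ℝ → X), 0 ≤ L ∧ γ 0 = x ∧ γ L = y ∧ γ '' Set.Icc 0 L = S ∧
    ∀ s ∈ Set.Icc 0 L, ∀ t ∈ Set.Icc 0 L, edist (γ s) (γ t) = ENNReal.ofReal |s - t|

/-- `A, B, C` are the sides of a geodesic triangle. -/
def IsGeodesicTriangle (A B C : Set X) : Prop :=
  ∃ x y z : X, IsGeodesic A x y ∧ IsGeodesic B y z ∧ IsGeodesic C z x

/-- Each side is contained in the `δ`-neighbourhood of the union of the two other sides. -/
def IsThin (δ : ℝ≥0) (A B C : Set X) : Prop :=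
  (∀ p ∈ A, Metric.infEDist p (B ∪ C) ≤ δ) ∧ (∀ p ∈ B, Metric.infEDist p (C ∪ A) ≤ δ) ∧
    ∀ p ∈ C, Metric.infEDist p (A ∪ B) ≤ δ

/-- Gromov hyperbolicity: all geodesic triangles are `δ`-thin for some `δ`. A geodesic triangle
lies in one component, so for a disconnected graph this is hyperbolicity of all the components
with a common constant. -/
def IsHyperbolic (X : Type*) [EMetricSpace X] : Prop :=
  ∃ δ : ℝ≥0, ∀ A B C : Set X, IsGeodesicTriangle A B C → IsThin δ A B C

end Hyperbolic

/-! ### Odd cycles and minimal cycles -/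

section Cycles

variable {V : Type*} {G : SimpleGraph V}

/-- The subgraph `C` is a cycle of odd length. -/
def IsOddCycle (C : G.Subgraph) : Prop :=
  ∃ (u : V) (p : G.Walk u u), p.IsCycle ∧ Odd p.length ∧ p.toSubgraph = C

/-- The walk `g` meets `C` exactly in its endpoints, and it is shorter than the distance of its
endpoints within `C`. -/
def IsShortcut (C : G.Subgraph) {u v : V} (g : G.Walk u v) : Prop :=
  ∃ (hu : u ∈ C.verts) (hv : v ∈ C.verts),
    g.toSubgraph.verts ∩ C.verts = {u, v} ∧ Disjoint g.toSubgraph.edgeSet C.edgeSet ∧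
      (g.length : ℕ∞) < C.coe.edist ⟨u, hu⟩ ⟨v, hv⟩

/-- `C'` is a reduction of `C`: both are odd cycles, and `C'` is the union of a subarc of `C` and a
shortcut of `C` joining the endpoints of the subarc. -/
def IsReduction (C C' : G.Subgraph) : Prop :=
  IsOddCycle C ∧ IsOddCycle C' ∧ ∃ (u v : V) (η : G.Walk u v) (g : G.Walk u v),
    η.IsPath ∧ η.toSubgraph ≤ C ∧ IsShortcut C g ∧ C' = η.toSubgraph ⊔ g.toSubgraph

/-- A minimal cycle: an odd cycle without a reduction. -/
def IsMinimalCycle (C : G.Subgraph) : Prop :=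
  IsOddCycle C ∧ ∀ C' : G.Subgraph, ¬ IsReduction C C'

/-- The points of the metric graph that lie on some minimal cycle. -/
def minimalCycles (G : SimpleGraph V) : Set (Realization G) :=
  ⋃ (C : G.Subgraph) (_ : IsMinimalCycle C), Realization.ofSubgraph C

end Cycles

end DirectProductHyperbolicity

/-! Suppose the product is hyperbolic, so that triangles of shortest walks in it are `N`-thin
(`IsHyperbolic.exists_thin_walks`). Take a shortest walk `p` in `G₁` from a minimal cycle `C` to a
minimal cycle `C'` through a vertex `u` far from all minimal cycles. Alternating along an edge of
`G₂`, with either starting end, gives two lifts of `p`. Both are shortest, since projecting to `G₁`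
does not increase distances.

The lifts have neighbouring ends. Over `C` their starting vertices can be joined within bounded
distance of the part of the product above `C` (`IsMinimalCycle.tracks`), because a minimal cycle is
isometric in `G₁` and its odd length permits a switch of parity; the same holds over `C'`. Thinness
then forces the point of one lift above `u` to be near one of the cycles or near the other lift. The
first is excluded by the choice of `u`. In the second case the bipartiteness of `G₂` turns the short
connection into a short odd closed walk in `G₁` near `u` (`exists_odd_walk_of_lifts_close`), and
repeated reduction finds a minimal cycle close to it (`exists_isMinimalCycle_near`), again a
contradiction. -/

open scoped ENNReal NNReal

namespace DirectProductHyperbolicity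

/-! ### From geodesics in the metric graph to shortest walks -/

section MetricGraph

variable {V : Type*} {G : SimpleGraph V}

namespace Realization

theorem vertex_coord_self (u : V) : (vertex G u).coord u = 1 := vertexCoord_self u

theorem eq_of_vertex_coord_ne_zero {u w : V} (h : (vertex G u).coord w ≠ 0) : w = u := by
  by_contra hne
  exact h (vertexCoord_of_ne hne)

theorem vertexDist_vertex_self (u : V) : vertexDist (vertex G u) (vertex G u) = 0 := by
  refine le_antisymm ?_ bot_le
  refine iInf_le_of_le u (iInf_le_of_le u (iInf_le_of_le ⟨?_, ?_⟩ ?_)) <;>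
    simp [vertex_coord_self]

/-- A vertex can be entered through itself at no cost, so the route along a common edge is never the
shorter one. -/
theorem edist_vertex_right (x : Realization G) (u : V) :
    edist x (vertex G u) = vertexDist x (vertex G u) := by
  rw [edist_def]
  refine min_eq_right ?_
  simpa [vertexDist_vertex_self] using vertexDist_le_edgeDist_add x (vertex G u) (vertex G u)

theorem edist_vertex_vertex (u v : V) :
    edist (vertex G u) (vertex G v) = (G.edist u v : ℝ≥0∞) := by
  rw [edist_vertex_right]
  apply le_antisymm
  · refine iInf_le_of_le u (iInf_le_of_le v (iInf_le_of_le ⟨?_, ?_⟩ ?_)) <;>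
      simp [vertex_coord_self]
  · refine le_iInf fun a => le_iInf fun b => le_iInf fun h => ?_
    rw [eq_of_vertex_coord_ne_zero h.1, eq_of_vertex_coord_ne_zero h.2]
    simp [vertex_coord_self]

/-- The point at distance `t` from `u` on the edge from `u` to `v`. -/
noncomputable def edgePoint (G : SimpleGraph V) {u v : V} (h : u = v ∨ G.Adj u v) (t : ℝ)
    (ht : t ∈ Set.Icc (0 : ℝ) 1) : Realization G :=
  ⟨(1 - t) • vertexCoord u + t • vertexCoord v, u, v, h,
    1 - t, t, sub_nonneg.2 ht.2, ht.1, by ring, rfl⟩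

theorem edist_edgePoint_le {u v : V} (h : u = v ∨ G.Adj u v) {s t : ℝ}
    (hs : s ∈ Set.Icc (0 : ℝ) 1) (ht : t ∈ Set.Icc (0 : ℝ) 1) :
    edist (edgePoint G h s hs) (edgePoint G h t ht) ≤ ENNReal.ofReal |s - t| := by
  rw [edist_def]
  refine min_le_of_left_le (iInf_le_of_le u (iInf_le_of_le v (iInf_le_of_le ⟨h, ?_, ?_⟩ ?_)))
  · exact ⟨1 - s, s, sub_nonneg.2 hs.2, hs.1, by ring, rfl⟩
  · exact ⟨1 - t, t, sub_nonneg.2 ht.2, ht.1, by ring, rfl⟩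
  · apply ENNReal.ofReal_le_ofReal
    by_cases huv : u = v
    · subst huv
      simp [edgePoint, vertexCoord_self]
    · simp only [edgePoint, Pi.add_apply, Pi.smul_apply, vertexCoord_self,
        vertexCoord_of_ne huv, smul_eq_mul, mul_one, mul_zero, add_zero]
      rw [show 1 - s - (1 - t) = -(s - t) by ring, abs_neg]

theorem edgePoint_zero {u v : V} (h : u = v ∨ G.Adj u v) (h0) :
    edgePoint G h 0 h0 = vertex G u := by
  ext w; simp [edgePoint, vertex]

theorem edgePoint_one {u v : V} (h : u = v ∨ G.Adj u v) (h1) :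
    edgePoint G h 1 h1 = vertex G v := by
  ext w; simp [edgePoint, vertex]

end Realization

open Realization

theorem getVert_eq_or_adj {u v : V} (p : G.Walk u v) (i : ℕ) :
    p.getVert i = p.getVert (i + 1) ∨ G.Adj (p.getVert i) (p.getVert (i + 1)) := by
  by_cases hi : i < p.length
  · exact Or.inr (p.adj_getVert_succ hi)
  · left
    rw [p.getVert_of_length_le (by omega), p.getVert_of_length_le (by omega)]

theorem edist_getVert_add_le {u v : V} (p : G.Walk u v) (i k : ℕ) :
    G.edist (p.getVert i) (p.getVert (i + k)) ≤ k := by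
  induction k with
  | zero => simp
  | succ k ih =>
    rw [Nat.cast_succ]
    refine (SimpleGraph.edist_triangle (v := p.getVert (i + k))).trans (add_le_add ih ?_)
    rw [SimpleGraph.edist_le_one_iff_adj_or_eq]
    exact (getVert_eq_or_adj p (i + k)).symm

/-- The parametrization of a walk by arc length. -/
noncomputable def walkPoint {u v : V} (p : G.Walk u v) (t : ℝ) : Realization G :=
  edgePoint G (getVert_eq_or_adj p ⌊t⌋₊) (Int.fract t)
    ⟨Int.fract_nonneg t, (Int.fract_lt_one t).le⟩

theorem walkPoint_natCast {u v : V} (p : G.Walk u v) (n : ℕ) :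
    walkPoint p n = vertex G (p.getVert n) := by
  ext w; simp [walkPoint, edgePoint, vertex]

theorem fract_eq_sub_natFloor {t : ℝ} (ht : 0 ≤ t) : Int.fract t = t - ⌊t⌋₊ := by
  rw [Int.fract, natCast_floor_eq_intCast_floor ht]

theorem edist_walkPoint_floor_le {u v : V} (p : G.Walk u v) {t : ℝ} (ht : 0 ≤ t) :
    edist (walkPoint p t) (vertex G (p.getVert ⌊t⌋₊)) ≤ ENNReal.ofReal (t - ⌊t⌋₊) := by
  rw [← edgePoint_zero (getVert_eq_or_adj p ⌊t⌋₊) ⟨le_rfl, zero_le_one⟩]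
  refine (edist_edgePoint_le _ _ _).trans_eq ?_
  rw [sub_zero, abs_of_nonneg (Int.fract_nonneg t), fract_eq_sub_natFloor ht]

theorem edist_walkPoint_floor_add_one_le {u v : V} (p : G.Walk u v) {t : ℝ} (ht : 0 ≤ t) :
    edist (walkPoint p t) (vertex G (p.getVert (⌊t⌋₊ + 1))) ≤ ENNReal.ofReal (⌊t⌋₊ + 1 - t) := by
  rw [← edgePoint_one (getVert_eq_or_adj p ⌊t⌋₊) ⟨zero_le_one, le_rfl⟩]
  refine (edist_edgePoint_le _ _ _).trans_eq ?_
  rw [abs_sub_comm, abs_of_nonneg (by linarith [Int.fract_lt_one t]), fract_eq_sub_natFloor ht]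
  congr 1; ring

theorem edist_walkPoint_le {u v : V} (p : G.Walk u v) {s t : ℝ} (hs : 0 ≤ s) (hst : s ≤ t) :
    edist (walkPoint p s) (walkPoint p t) ≤ ENNReal.ofReal (t - s) := by
  have ht := hs.trans hst
  rcases (Nat.floor_le_floor hst).eq_or_lt with h | h
  · have hp : walkPoint p t = edgePoint G (getVert_eq_or_adj p ⌊s⌋₊) (Int.fract t)
        ⟨Int.fract_nonneg t, (Int.fract_lt_one t).le⟩ := by
      ext w; simp [walkPoint, edgePoint, h]
    rw [hp]
    refine (edist_edgePoint_le _ _ _).trans_eq ?_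
    rw [fract_eq_sub_natFloor hs, fract_eq_sub_natFloor ht, h, abs_sub_comm, abs_of_nonneg]
    · congr 1; ring
    · linarith
  -- The points lie on different edges of the walk: go to the next vertex, along `k` full edges,
  -- then into the last edge.
  · obtain ⟨k, hk⟩ := Nat.exists_eq_add_of_lt h
    have h1 : edist (vertex G (p.getVert (⌊s⌋₊ + 1))) (vertex G (p.getVert ⌊t⌋₊)) ≤
        ENNReal.ofReal k := by
      rw [edist_vertex_vertex, hk, show ⌊s⌋₊ + k + 1 = ⌊s⌋₊ + 1 + k by omega,
        ENNReal.ofReal_natCast]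
      exact_mod_cast edist_getVert_add_le p (⌊s⌋₊ + 1) k
    have h2 := edist_walkPoint_floor_add_one_le p hs
    have h3 := edist_walkPoint_floor_le p ht
    rw [edist_comm] at h3
    have f1 := Nat.lt_floor_add_one s
    have f2 := Nat.floor_le ht
    refine (edist_triangle4 _ _ _ _).trans ((add_le_add (add_le_add h2 h1) h3).trans_eq ?_)
    rw [← ENNReal.ofReal_add (by linarith) (by positivity),
      ← ENNReal.ofReal_add (by linarith [k.cast_nonneg (α := ℝ)]) (by linarith)]
    congr 1
    have : (⌊t⌋₊ : ℝ) = ⌊s⌋₊ + k + 1 := by exact_mod_cast hk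
    rw [this]; ring

/-- A 1-Lipschitz curve is a geodesic if its endpoints are as far apart as possible. -/
theorem edist_eq_of_lipschitz {X : Type*} [EMetricSpace X] {L : ℝ} {γ : ℝ → X}
    (hγ : ∀ s t, 0 ≤ s → s ≤ t → edist (γ s) (γ t) ≤ ENNReal.ofReal (t - s))
    (hL : ENNReal.ofReal L ≤ edist (γ 0) (γ L)) {s t : ℝ} (hs : 0 ≤ s) (hst : s ≤ t)
    (ht : t ≤ L) : edist (γ s) (γ t) = ENNReal.ofReal (t - s) := by
  refine le_antisymm (hγ s t hs hst) ?_
  have h1 := hγ 0 s le_rfl hs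
  have h2 := hγ t L (hs.trans hst) ht
  -- The three pieces `0, s, t, L` have upper bounds with sum `L`, so none of these bounds can be
  -- strict.
  have h3 := hL.trans ((edist_triangle4 _ (γ s) (γ t) _).trans
    (add_le_add (add_le_add_left h1 _) h2))
  rw [show L = s + (t - s) + (L - t) by ring, ENNReal.ofReal_add (by linarith) (by linarith),
    ENNReal.ofReal_add (by linarith) (by linarith), sub_zero,
    show s + (t - s) + (L - t) - t = L - t by ring] at h3
  exact (ENNReal.add_le_add_iff_left ENNReal.ofReal_ne_top).1
    ((ENNReal.add_le_add_iff_right ENNReal.ofReal_ne_top).1 h3)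

/-- The arc-length parametrization is 1-Lipschitz, and the walk being shortest makes its endpoints
as far apart as possible. -/
theorem exists_isGeodesic_of_walk {u v : V} (p : G.Walk u v)
    (hp : (p.length : ℕ∞) ≤ G.edist u v) :
    ∃ S : Set (Realization G), IsGeodesic S (vertex G u) (vertex G v) ∧
      (∀ w ∈ p.support, vertex G w ∈ S) ∧
      ∀ q ∈ S, ∃ w ∈ p.support, edist q (vertex G w) ≤ 1 := by
  have h0 : walkPoint p 0 = vertex G u := by
    simpa using walkPoint_natCast p 0
  have hL : walkPoint p p.length = vertex G v := by
    simpa using walkPoint_natCast p p.length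
  have hlen : ENNReal.ofReal p.length ≤ edist (walkPoint p 0) (walkPoint p p.length) := by
    rw [h0, hL, edist_vertex_vertex, ENNReal.ofReal_natCast]
    exact_mod_cast hp
  refine ⟨walkPoint p '' Set.Icc 0 p.length, ⟨p.length, walkPoint p, by positivity, h0, hL, rfl,
    fun s hs t ht => ?_⟩, fun w hw => ?_, ?_⟩
  · rcases le_total s t with h | h
    · rw [edist_eq_of_lipschitz (fun _ _ => edist_walkPoint_le p) hlen hs.1 h ht.2,
        abs_sub_comm, abs_of_nonneg (by linarith)]
    · rw [edist_comm, edist_eq_of_lipschitz (fun _ _ => edist_walkPoint_le p) hlen ht.1 h hs.2,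
        abs_of_nonneg (by linarith)]
  · obtain ⟨n, rfl, hn⟩ := SimpleGraph.Walk.mem_support_iff_exists_getVert.1 hw
    exact ⟨n, ⟨by positivity, by exact_mod_cast hn⟩, walkPoint_natCast p n⟩
  · rintro _ ⟨t, ht, rfl⟩
    refine ⟨_, p.getVert_mem_support ⌊t⌋₊, (edist_walkPoint_floor_le p ht.1).trans ?_⟩
    rw [ENNReal.ofReal_le_one]
    linarith [Nat.lt_floor_add_one t]

/-- In a hyperbolic graph, triangles of shortest walks are uniformly thin. -/
theorem IsHyperbolic.exists_thin_walks (h : IsHyperbolic (Realization G)) :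
    ∃ N : ℕ, ∀ (x y z : V) (p : G.Walk x y) (q : G.Walk y z) (r : G.Walk x z),
      (p.length : ℕ∞) ≤ G.edist x y → (q.length : ℕ∞) ≤ G.edist y z →
      (r.length : ℕ∞) ≤ G.edist x z → ∀ w ∈ r.support,
        ∃ s, (s ∈ p.support ∨ s ∈ q.support) ∧ G.edist w s ≤ N := by
  obtain ⟨δ, hδ⟩ := h
  -- One unit is spent because the infimum distance need not be attained, the other on moving to a
  -- vertex of the walk.
  refine ⟨⌈δ⌉₊ + 2, fun x y z p q r hp hq hr w hw => ?_⟩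
  obtain ⟨A, hA, -, hA2⟩ := exists_isGeodesic_of_walk p hp
  obtain ⟨B, hB, -, hB2⟩ := exists_isGeodesic_of_walk q hq
  obtain ⟨C, hC, hC1, -⟩ := exists_isGeodesic_of_walk r.reverse
    (by rwa [SimpleGraph.Walk.length_reverse, SimpleGraph.edist_comm])
  have hw' := (hδ A B C ⟨_, _, _, hA, hB, hC⟩).2.2 _ (hC1 w (by simpa using hw))
  have hlt : Metric.infEDist (vertex G w) (A ∪ B) < (δ : ℝ≥0∞) + 1 :=
    hw'.trans_lt (ENNReal.lt_add_right ENNReal.coe_ne_top one_ne_zero)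
  obtain ⟨t, ht, htw⟩ := Metric.infEDist_lt_iff.1 hlt
  obtain ⟨s, hs, hts⟩ : ∃ s, (s ∈ p.support ∨ s ∈ q.support) ∧ edist t (vertex G s) ≤ 1 := by
    rcases ht with ht | ht
    · obtain ⟨s, hs, h⟩ := hA2 t ht
      exact ⟨s, Or.inl hs, h⟩
    · obtain ⟨s, hs, h⟩ := hB2 t ht
      exact ⟨s, Or.inr hs, h⟩
  refine ⟨s, hs, ?_⟩
  have h1 : (G.edist w s : ℝ≥0∞) ≤ ((⌈δ⌉₊ + 2 : ℕ) : ℝ≥0∞) := by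
    rw [← edist_vertex_vertex]
    refine (edist_triangle _ t _).trans ((add_le_add htw.le hts).trans ?_)
    have : (δ : ℝ≥0∞) ≤ (⌈δ⌉₊ : ℝ≥0∞) := by exact_mod_cast Nat.le_ceil δ
    calc (δ : ℝ≥0∞) + 1 + 1 ≤ ⌈δ⌉₊ + 1 + 1 := by gcongr
      _ = _ := by push_cast; rw [add_assoc, one_add_one_eq_two]
  exact_mod_cast h1

/-- The infimum defining the distance runs over the at most two endpoints of the edge of `x`, so it
is attained. -/
theorem exists_vertex_edist_eq {C : G.Subgraph} {x : Realization G} (hx : x ∈ ofSubgraph C)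
    (u : V) : ∃ a ∈ C.verts, x.coord a ≠ 0 ∧
      edist x (vertex G u) = ENNReal.ofReal (1 - x.coord a) + (G.edist a u : ℝ≥0∞) := by
  classical
  obtain ⟨p, hp, q, hq, -, hpq⟩ := hx
  have hsupp : ∀ a, x.coord a ≠ 0 → a = p ∨ a = q := by
    intro a ha
    by_contra! hc
    exact ha ((coord_of_mem_closedEdge hpq).2.2.1 a hc.1 hc.2)
  have hne : (({p, q} : Finset V).filter (fun a => x.coord a ≠ 0)).Nonempty := by
    obtain ⟨a, ha⟩ := x.exists_coord_ne_zero
    exact ⟨a, by simpa [ha] using hsupp a ha⟩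
  obtain ⟨a, ha, hmin⟩ := Finset.exists_min_image _
    (fun a => ENNReal.ofReal (1 - x.coord a) + (G.edist a u : ℝ≥0∞)) hne
  simp only [Finset.mem_filter, Finset.mem_insert, Finset.mem_singleton] at ha hmin
  refine ⟨a, by rcases ha.1 with rfl | rfl <;> assumption, ha.2, ?_⟩
  rw [edist_vertex_right]
  apply le_antisymm
  · refine iInf_le_of_le a (iInf_le_of_le u (iInf_le_of_le ⟨ha.2, ?_⟩ ?_)) <;>
      simp [vertex_coord_self]
  · refine le_iInf fun b => le_iInf fun v => le_iInf fun h => ?_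
    rw [eq_of_vertex_coord_ne_zero h.2]
    simpa [vertex_coord_self] using hmin b ⟨hsupp b h.1, h.1⟩

/-- A geodesic between points of two subgraphs contains a geodesic between two of their vertices,
up to the two edges at its ends. -/
theorem exists_vertices_of_isGeodesic {C C' : G.Subgraph} {x y : Realization G}
    (hx : x ∈ ofSubgraph C) (hy : y ∈ ofSubgraph C') {S : Set (Realization G)}
    (hS : IsGeodesic S x y) {u : V} (hu : vertex G u ∈ S) :
    ∃ a ∈ C.verts, ∃ b ∈ C'.verts, G.edist a u + G.edist u b ≤ G.edist a b := by
  obtain ⟨a, ha, hxa, hxu⟩ := exists_vertex_edist_eq hx u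
  obtain ⟨b, hb, hyb, hyu⟩ := exists_vertex_edist_eq hy u
  obtain ⟨L, γ, hL, rfl, rfl, rfl, hγ⟩ := hS
  obtain ⟨t, ht, htu⟩ := hu
  refine ⟨a, ha, b, hb, ?_⟩
  have hsum : edist (γ 0) (γ t) + edist (γ L) (γ t) = edist (γ 0) (γ L) := by
    rw [hγ _ ⟨le_rfl, hL⟩ _ ht, hγ _ ⟨hL, le_rfl⟩ _ ht, hγ _ ⟨le_rfl, hL⟩ _ ⟨hL, le_rfl⟩,
      ← ENNReal.ofReal_add (abs_nonneg _) (abs_nonneg _)]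
    congr 1
    rw [zero_sub, zero_sub, abs_neg, abs_neg, abs_of_nonneg hL, abs_of_nonneg ht.1,
      abs_of_nonneg (by linarith [ht.2])]
    ring
  have hle : edist (γ 0) (γ L) ≤ ENNReal.ofReal (1 - (γ 0).coord a) + (G.edist a b : ℝ≥0∞) +
      ENNReal.ofReal (1 - (γ L).coord b) := by
    rw [edist_def]
    exact (min_le_right _ _).trans
      (iInf_le_of_le a (iInf_le_of_le b (iInf_le_of_le ⟨hxa, hyb⟩ le_rfl)))
  -- Both sides now contain the same finite end pieces, from `x` to `a` and from `b` to `y`; they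
  -- cancel.
  rw [← hsum, htu, hxu, hyu, SimpleGraph.edist_comm (u := b)] at hle
  have h1 : ENNReal.ofReal (1 - (γ 0).coord a) +
      ((G.edist a u : ℝ≥0∞) + (G.edist u b : ℝ≥0∞)) + ENNReal.ofReal (1 - (γ L).coord b) ≤
      ENNReal.ofReal (1 - (γ 0).coord a) + (G.edist a b : ℝ≥0∞) +
      ENNReal.ofReal (1 - (γ L).coord b) := le_of_eq_of_le (by ring) hle
  have h2 := (ENNReal.add_le_add_iff_left ENNReal.ofReal_ne_top).1
    ((ENNReal.add_le_add_iff_right ENNReal.ofReal_ne_top).1 h1)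
  exact_mod_cast h2

theorem infEDist_minimalCycles_le {C : G.Subgraph} (hC : IsMinimalCycle C) {w : V}
    (hw : w ∈ C.verts) (u : V) :
    Metric.infEDist (vertex G u) (minimalCycles G) ≤ (G.edist u w : ℝ≥0∞) := by
  rw [← edist_vertex_vertex]
  refine Metric.infEDist_le_edist_of_mem ?_
  simp only [minimalCycles, Set.mem_iUnion]
  exact ⟨C, hC, w, hw, w, hw, Or.inl rfl, left_mem_segment ℝ _ _⟩

end MetricGraph

/-! ### Odd closed walks and minimal cycles -/

section OddCycles

variable {V : Type*} {G : SimpleGraph V}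

/-- A walk can be shortened to a path of the same parity unless it contains an odd cycle. -/
theorem exists_isPath_or_odd_isCycle {u v : V} (p : G.Walk u v) :
    (∃ q : G.Walk u v, q.IsPath ∧ q.length ≤ p.length ∧ (Even q.length ↔ Even p.length)) ∨
      ∃ (w : V) (c : G.Walk w w), c.IsCycle ∧ Odd c.length ∧ c.length ≤ p.length ∧
        w ∈ p.support := by
  classical
  induction p with
  | nil => exact Or.inl ⟨.nil, by simp, le_rfl, Iff.rfl⟩
  | @cons u u' v h p ih =>
    rcases ih with ⟨q, hq, hle, heven⟩ | ⟨w, c, hc, hodd, hle, hw⟩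
    · by_cases hu : u ∈ q.support
      · have hlen := congrArg SimpleGraph.Walk.length (q.take_spec hu)
        rw [SimpleGraph.Walk.length_append] at hlen
        have htake := hq.takeUntil hu
        -- The new edge closes up with the initial part of `q`. If this loop is odd it is the
        -- required cycle; if it is even, cutting it off preserves parity.
        by_cases he : Even (q.takeUntil u hu).length
        · right
          refine ⟨u, .cons h (q.takeUntil u hu), ?_, ?_, ?_, by simp⟩
          · rw [SimpleGraph.Walk.cons_isCycle_iff]
            refine ⟨htake, fun hmem => ?_⟩
            rw [Sym2.eq_swap] at hmem
            have := htake.length_eq_one_of_mem_edges hmem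
            rw [this] at he
            exact absurd he (by decide)
          · rw [SimpleGraph.Walk.length_cons]
            exact he.add_one
          · simp only [SimpleGraph.Walk.length_cons]
            omega
        · left
          refine ⟨q.dropUntil u hu, hq.dropUntil hu, ?_, ?_⟩
          · simp only [SimpleGraph.Walk.length_cons]
            omega
          · rw [SimpleGraph.Walk.length_cons, Nat.even_add_one, ← heven, ← hlen, Nat.even_add]
            tauto
      · left
        refine ⟨.cons h q, hq.cons hu, by simpa using hle, ?_⟩
        simp only [SimpleGraph.Walk.length_cons, Nat.even_add_one, heven]
    · right
      refine ⟨w, c, hc, hodd, ?_, ?_⟩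
      · simp only [SimpleGraph.Walk.length_cons]
        omega
      · simp [hw]

theorem exists_odd_isCycle {u : V} (p : G.Walk u u) (hp : Odd p.length) :
    ∃ (w : V) (c : G.Walk w w), c.IsCycle ∧ Odd c.length ∧ c.length ≤ p.length ∧
      w ∈ p.support := by
  rcases exists_isPath_or_odd_isCycle p with ⟨q, hq, -, heven⟩ | h
  · rw [SimpleGraph.Walk.isPath_iff_nil] at hq
    have := SimpleGraph.Walk.length_eq_zero_iff.2 hq
    rw [this] at heven
    exact absurd (heven.1 (by decide)) (Nat.not_even_iff_odd.2 hp)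
  · exact h

theorem colorable_two_of_not_exists_isOddCycle (h : ¬ ∃ C : G.Subgraph, IsOddCycle C) :
    G.Colorable 2 := by
  rw [SimpleGraph.two_colorable_iff_forall_loop_even]
  intro u p
  by_contra hp
  obtain ⟨w, c, hc, hodd, -⟩ := exists_odd_isCycle p (Nat.not_even_iff_odd.1 hp)
  exact h ⟨_, w, c, hc, hodd, rfl⟩

theorem edist_le_length_of_mem_support {u v w : V} (p : G.Walk u v) (hw : w ∈ p.support) :
    G.edist u w ≤ p.length := by
  classical
  refine (SimpleGraph.edist_le (p.takeUntil w hw)).trans ?_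
  exact_mod_cast p.length_takeUntil_le_length hw

theorem edist_coe_le_length {C : G.Subgraph} {u v : V} (p : G.Walk u v)
    (hp : p.toSubgraph ≤ C) (hu : u ∈ C.verts) (hv : v ∈ C.verts) :
    C.coe.edist ⟨u, hu⟩ ⟨v, hv⟩ ≤ p.length := by
  have h := SimpleGraph.edist_le (p.mapToSubgraph.map (SimpleGraph.Subgraph.inclusion hp))
  rw [SimpleGraph.Walk.length_map, ← SimpleGraph.Walk.length_map p.toSubgraph.hom,
    SimpleGraph.Walk.map_mapToSubgraph_hom] at h
  exact h

theorem IsOddCycle.connected {C : G.Subgraph} (hC : IsOddCycle C) : C.Connected := by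
  obtain ⟨u, c, -, -, rfl⟩ := hC
  exact c.toSubgraph_connected

/-- Two vertices of a cycle split it into two arcs. -/
theorem exists_arcs {z u v : V} {c : G.Walk z z} (hc : c.IsCycle) (hu : u ∈ c.support)
    (hv : v ∈ c.support) (huv : u ≠ v) :
    ∃ p q : G.Walk u v, p.IsPath ∧ q.IsPath ∧ p.toSubgraph ≤ c.toSubgraph ∧
      q.toSubgraph ≤ c.toSubgraph ∧ p.length + q.length = c.length := by
  classical
  have hc' := hc.rotate hu
  have hv' : v ∈ (c.rotate u hu).support := by
    rw [← SimpleGraph.Walk.mem_verts_toSubgraph, SimpleGraph.Walk.toSubgraph_rotate]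
    exact c.mem_verts_toSubgraph.2 hv
  have hspec := (c.rotate u hu).take_spec hv'
  have hsub : ((c.rotate u hu).takeUntil v hv').toSubgraph ⊔
      ((c.rotate u hu).dropUntil v hv').toSubgraph = c.toSubgraph := by
    rw [← SimpleGraph.Walk.toSubgraph_append, hspec, SimpleGraph.Walk.toSubgraph_rotate]
  have hlen := congrArg SimpleGraph.Walk.length hspec
  rw [SimpleGraph.Walk.length_append, SimpleGraph.Walk.length_rotate] at hlen
  rw [← hspec] at hc'
  refine ⟨(c.rotate u hu).takeUntil v hv', ((c.rotate u hu).dropUntil v hv').reverse,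
    hc'.isPath_of_append_left (SimpleGraph.Walk.not_nil_of_ne huv.symm),
    (hc'.isPath_of_append_right (SimpleGraph.Walk.not_nil_of_ne huv)).reverse, ?_, ?_, ?_⟩
  · exact hsub ▸ le_sup_left
  · rw [SimpleGraph.Walk.toSubgraph_reverse]
    exact hsub ▸ le_sup_right
  · rw [SimpleGraph.Walk.length_reverse, hlen]

theorem start_notMem_support_tail {u v : V} {p : G.Walk u v} (hp : p.IsPath) :
    u ∉ p.support.tail := by
  have h := hp.support_nodup
  rw [← p.cons_tail_support] at h
  exact (List.nodup_cons.1 h).1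

/-- A cycle with a shortcut that is a path has a reduction. -/
theorem IsShortcut.exists_isReduction {C : G.Subgraph} (hC : IsOddCycle C) {u v : V}
    {g : G.Walk u v} (hg : IsShortcut C g) (hpath : g.IsPath) : ∃ C', IsReduction C C' := by
  have hC' := hC
  obtain ⟨z, c, hc, hodd, rfl⟩ := hC'
  have hg' := hg
  obtain ⟨hu, hv, hverts, -, hlt⟩ := hg'
  have huv : u ≠ v := by
    rintro rfl
    simp at hlt
  obtain ⟨p, q, hp, hq, hpC, hqC, hpq⟩ := exists_arcs hc (c.mem_verts_toSubgraph.1 hu)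
    (c.mem_verts_toSubgraph.1 hv) huv
  obtain ⟨η, hη, hηC, hηodd⟩ : ∃ η : G.Walk u v, η.IsPath ∧ η.toSubgraph ≤ c.toSubgraph ∧
      Odd (η.length + g.length) := by
    -- The two arcs have different parities, as their lengths add up to an odd number, so exactly
    -- one closes up with `g` to an odd cycle.
    by_cases h : Odd (p.length + g.length)
    · exact ⟨p, hp, hpC, h⟩
    · refine ⟨q, hq, hqC, ?_⟩
      rw [← hpq] at hodd
      rw [Nat.odd_add] at hodd h ⊢
      rw [← Nat.not_odd_iff_even] at hodd h ⊢
      tauto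
  refine ⟨η.toSubgraph ⊔ g.toSubgraph, hC, ⟨u, η.append g.reverse, ?_, ?_, ?_⟩,
    u, v, η, g, hη, hηC, hg, rfl⟩
  · refine hη.isCycle_append hpath.reverse ?_ ?_
    · intro w hw hw'
      have h1 : w ∈ g.toSubgraph.verts ∩ c.toSubgraph.verts := by
        refine ⟨?_, hηC.1 (η.mem_verts_toSubgraph.2 (List.mem_of_mem_tail hw))⟩
        have := List.mem_of_mem_tail hw'
        rw [SimpleGraph.Walk.mem_verts_toSubgraph]
        simpa using this
      rw [hverts] at h1
      rcases h1 with rfl | rfl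
      · exact start_notMem_support_tail hη hw
      · exact start_notMem_support_tail hpath.reverse hw'
    · have h1 : 0 < η.length := by
        by_contra h0
        exact huv (η.eq_of_length_eq_zero (by omega))
      have h2 : 0 < g.length := by
        by_contra h0
        exact huv (g.eq_of_length_eq_zero (by omega))
      rw [SimpleGraph.Walk.length_reverse]
      -- Two single edges would not form a cycle, but their total length 2 is even.
      by_contra! hc
      rw [show η.length + g.length = 2 by omega] at hηodd
      exact absurd hηodd (by decide)
  · rwa [SimpleGraph.Walk.length_append, SimpleGraph.Walk.length_reverse]
  · rw [SimpleGraph.Walk.toSubgraph_append, SimpleGraph.Walk.toSubgraph_reverse]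

/-- Minimal cycles are isometrically embedded. -/
theorem IsMinimalCycle.edist_coe_le_length {C : G.Subgraph} (hC : IsMinimalCycle C) {u v : V}
    (hu : u ∈ C.verts) (hv : v ∈ C.verts) (g : G.Walk u v) :
    C.coe.edist ⟨u, hu⟩ ⟨v, hv⟩ ≤ g.length := by
  classical
  induction hn : g.length using Nat.strong_induction_on generalizing u v with
  | _ n ih =>
    subst hn
    by_contra! hlt
    have huv : u ≠ v := by
      rintro rfl
      simp at hlt
    -- A shortest counterexample `g` is a path and, by the next step, meets `C` only at its ends.
    -- Hence it is a shortcut, and `C` has a reduction.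
    have hpath : g.IsPath := by
      have h1 := g.length_bypass_le_length
      rcases h1.lt_or_eq with h | h
      · have h2 := (ih _ h hu hv g.bypass rfl).trans (Nat.cast_le.2 h1)
        exact absurd hlt h2.not_gt
      · rw [← g.bypass_eq_self_of_length_le_length_bypass h.ge]
        exact g.bypass_isPath
    have hint : ∀ r ∈ g.support, r ∈ C.verts → r = u ∨ r = v := by
      intro r hr hrC
      by_contra! hne
      have h1 := ih _ (g.length_takeUntil_lt_length hr hne.2) hu hrC _ rfl
      have h2 := ih _ (g.length_dropUntil_lt_length hr hne.1) hrC hv _ rfl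
      have h3 := congrArg SimpleGraph.Walk.length (g.take_spec hr)
      rw [SimpleGraph.Walk.length_append] at h3
      refine hlt.not_ge (SimpleGraph.edist_triangle.trans ((add_le_add h1 h2).trans_eq ?_))
      exact_mod_cast h3
    have hpos : 0 < g.length := by
      by_contra h0
      exact huv (g.eq_of_length_eq_zero (by omega))
    have hshort : IsShortcut C g := by
      refine ⟨hu, hv, ?_, ?_, hlt⟩
      · ext r
        simp only [Set.mem_inter_iff, SimpleGraph.Walk.mem_verts_toSubgraph,
          Set.mem_insert_iff, Set.mem_singleton_iff]
        refine ⟨fun h => hint r h.1 h.2, ?_⟩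
        rintro (rfl | rfl)
        · exact ⟨g.start_mem_support, hu⟩
        · exact ⟨g.end_mem_support, hv⟩
      · rw [Set.disjoint_left]
        intro e he heC
        induction e with | _ a b =>
        rw [SimpleGraph.Subgraph.mem_edgeSet] at he heC
        -- A common edge would join `u` and `v` in `C`, leaving only length 0 for `g`.
        have hadj : C.Adj u v := by
          have ha := hint a (g.mem_verts_toSubgraph.1 he.fst_mem) heC.fst_mem
          have hb := hint b (g.mem_verts_toSubgraph.1 he.snd_mem) heC.snd_mem
          have hab := heC.ne
          rcases ha with rfl | rfl <;> rcases hb with rfl | rfl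
          · exact absurd rfl hab
          · exact heC
          · exact heC.symm
          · exact absurd rfl hab
        have h1 : C.coe.edist ⟨u, hu⟩ ⟨v, hv⟩ = 1 := SimpleGraph.edist_eq_one_iff_adj.2 hadj
        rw [h1] at hlt
        have : g.length < 1 := by exact_mod_cast hlt
        omega
    obtain ⟨C', hC'⟩ := hshort.exists_isReduction hC.1 hpath
    exact hC.2 C' hC'

/-- There is a minimal cycle near every short odd closed walk. -/
theorem exists_isMinimalCycle_near (n : ℕ) {u : V} (p : G.Walk u u) (hodd : Odd p.length)
    (hn : p.length ≤ n) :
    ∃ C : G.Subgraph, IsMinimalCycle C ∧ ∃ w ∈ C.verts, G.edist u w ≤ (2 * n ^ 2 : ℕ) := by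
  induction n generalizing u with
  | zero =>
    rw [Nat.le_zero.1 hn] at hodd
    exact absurd hodd (by decide)
  | succ n ih =>
    obtain ⟨z, c, hc, hcodd, hcp, hz⟩ := exists_odd_isCycle p hodd
    have hC : IsOddCycle c.toSubgraph := ⟨z, c, hc, hcodd, rfl⟩
    have huz : G.edist u z ≤ (n + 1 : ℕ) :=
      (edist_le_length_of_mem_support p hz).trans (Nat.cast_le.2 hn)
    by_cases hmin : IsMinimalCycle c.toSubgraph
    · refine ⟨_, hmin, z, c.start_mem_verts_toSubgraph, huz.trans (Nat.cast_le.2 ?_)⟩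
      nlinarith
    · obtain ⟨C', -, -, x, y, -, g, -, -, ⟨hx, hy, -, -, hlt⟩, -⟩ :
          ∃ C', IsReduction c.toSubgraph C' := by
        by_contra! h
        exact hmin ⟨hC, h⟩
      have hxy : x ≠ y := by
        rintro rfl
        simp at hlt
      have hx' := c.mem_verts_toSubgraph.1 hx
      obtain ⟨q, q', -, -, hqC, hqC', hqq⟩ := exists_arcs hc hx' (c.mem_verts_toSubgraph.1 hy) hxy
      have h1 : g.length < q.length := by
        exact_mod_cast hlt.trans_le (edist_coe_le_length q hqC hx hy)
      have h2 : g.length < q'.length := by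
        exact_mod_cast hlt.trans_le (edist_coe_le_length q' hqC' hx hy)
      -- The shortcut is shorter than either arc, so replacing the arc of the same parity as `g`
      -- gives a strictly shorter odd closed walk, to which induction applies.
      obtain ⟨η, hηodd, hη⟩ : ∃ η : G.Walk x y, Odd (η.length + g.length) ∧
          η.length + g.length < c.length := by
        by_cases h : Odd (q.length + g.length)
        · exact ⟨q, h, by omega⟩
        · refine ⟨q', ?_, by omega⟩
          rw [← hqq] at hcodd
          rw [Nat.odd_add] at hcodd h ⊢
          rw [← Nat.not_odd_iff_even] at hcodd h ⊢
          tauto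
      obtain ⟨D, hD, w, hw, hxw⟩ := ih (η.append g.reverse)
        (by rwa [SimpleGraph.Walk.length_append, SimpleGraph.Walk.length_reverse])
        (by rw [SimpleGraph.Walk.length_append, SimpleGraph.Walk.length_reverse]; omega)
      refine ⟨D, hD, w, hw, ?_⟩
      have hzx : G.edist z x ≤ (n + 1 : ℕ) :=
        (edist_le_length_of_mem_support c hx').trans (Nat.cast_le.2 (hcp.trans hn))
      refine (SimpleGraph.edist_triangle (v := x)).trans ((add_le_add
        ((SimpleGraph.edist_triangle (v := z)).trans (add_le_add huz hzx)) hxw).trans ?_)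
      norm_cast
      have : 1 ≤ n := by
        have := hcodd.pos
        omega
      -- The way `u`, `z`, `x` costs at most `2 * (n + 1)`, which is less than the growth of `2 * n
      -- ^ 2`.
      nlinarith

/-- An odd cycle has an edge whose endpoints are equidistant from a given vertex. -/
theorem IsOddCycle.exists_adj_dist_eq {C : G.Subgraph} (hC : IsOddCycle C) (a : C.verts) :
    ∃ x y : C.verts, C.coe.Adj x y ∧ C.coe.dist a x = C.coe.dist a y := by
  by_contra! hne
  have hconn : C.coe.Connected := hC.connected.coe
  -- If no edge is equidistant from `a`, the distance to `a` changes parity along every edge, which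
  -- makes all closed walks even.
  have key : ∀ {x y : C.verts} (p : C.coe.Walk x y),
      Even p.length ↔ (Even (C.coe.dist a x) ↔ Even (C.coe.dist a y)) := by
    intro x y p
    induction p with
    | nil => simp
    | @cons x y z h p ih =>
      have h1 := hne x y h
      have h2 : C.coe.dist a y ≤ C.coe.dist a x + 1 := by
        simpa [SimpleGraph.dist_eq_one_iff_adj.2 h] using
          hconn.dist_triangle (u := a) (v := x) (w := y)
      have h3 : C.coe.dist a x ≤ C.coe.dist a y + 1 := by
        simpa [SimpleGraph.dist_eq_one_iff_adj.2 h.symm] using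
          hconn.dist_triangle (u := a) (v := y) (w := x)
      have h4 : Even (C.coe.dist a x) ↔ ¬ Even (C.coe.dist a y) := by
        simp only [Nat.even_iff]
        omega
      rw [SimpleGraph.Walk.length_cons, Nat.even_add_one, ih]
      tauto
  obtain ⟨z, c, -, hodd, rfl⟩ := hC
  have h := (key c.mapToSubgraph).2 Iff.rfl
  rw [← SimpleGraph.Walk.length_map c.toSubgraph.hom, SimpleGraph.Walk.map_mapToSubgraph_hom] at h
  exact absurd h (Nat.not_even_iff_odd.2 hodd)

end OddCycles

/-! ### Chaining thin triangles -/

section Tracking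

variable {V : Type*} {G : SimpleGraph V}

/-- The vertices `u` and `v` are connected, and all shortest walks between them stay in the
`k`-neighbourhood of `S`. -/
def Tracks (G : SimpleGraph V) (k : ℕ) (S : Set V) (u v : V) : Prop :=
  G.Reachable u v ∧ ∀ r : G.Walk u v, (r.length : ℕ∞) ≤ G.edist u v → ∀ w ∈ r.support,
    ∃ s ∈ S, G.edist w s ≤ k

/-- All triangles of shortest walks are `N`-thin. -/
def ThinWalks (G : SimpleGraph V) (N : ℕ) : Prop :=
  ∀ (x y z : V) (p : G.Walk x y) (q : G.Walk y z) (r : G.Walk x z),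
    (p.length : ℕ∞) ≤ G.edist x y → (q.length : ℕ∞) ≤ G.edist y z →
    (r.length : ℕ∞) ≤ G.edist x z → ∀ w ∈ r.support,
      ∃ s, (s ∈ p.support ∨ s ∈ q.support) ∧ G.edist w s ≤ N

theorem Tracks.mono {k k' : ℕ} {S S' : Set V} {u v : V} (h : Tracks G k S u v) (hk : k ≤ k')
    (hS : S ⊆ S') : Tracks G k' S' u v := by
  refine ⟨h.1, fun r hr w hw => ?_⟩
  obtain ⟨s, hs, hws⟩ := h.2 r hr w hw
  exact ⟨s, hS hs, hws.trans (Nat.cast_le.2 hk)⟩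

/-- Each further leg costs one thin triangle, hence one more `N`. -/
theorem Tracks.trans {N : ℕ} (hN : ThinWalks G N) {k : ℕ} {S : Set V} {u v w : V}
    (h : Tracks G k S u v) (h' : Tracks G k S v w) : Tracks G (k + N) S u w := by
  refine ⟨h.1.trans h'.1, fun r hr t ht => ?_⟩
  obtain ⟨p, hp⟩ := h.1.exists_walk_length_eq_edist
  obtain ⟨q, hq⟩ := h'.1.exists_walk_length_eq_edist
  obtain ⟨t', ht', htt⟩ := hN u v w p q r hp.le hq.le hr t ht
  obtain ⟨s, hs, hts⟩ : ∃ s ∈ S, G.edist t' s ≤ k := by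
    rcases ht' with ht' | ht'
    · exact h.2 p hp.le t' ht'
    · exact h'.2 q hq.le t' ht'
  refine ⟨s, hs, SimpleGraph.edist_triangle.trans ((add_le_add htt hts).trans_eq ?_)⟩
  push_cast
  rw [add_comm]

/-- Two shortest walks with common ends form a triangle whose third side is the trivial walk. -/
theorem Tracks.of_walk {N : ℕ} (hN : ThinWalks G N) {S : Set V} {u v : V} (p : G.Walk u v)
    (hp : (p.length : ℕ∞) ≤ G.edist u v) (hS : ∀ w ∈ p.support, w ∈ S) : Tracks G N S u v := by
  refine ⟨p.reachable, fun r hr w hw => ?_⟩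
  obtain ⟨s, hs, hws⟩ := hN u v v p .nil r hp (by simp) hr w hw
  refine ⟨s, hS s (hs.elim id fun h => ?_), hws⟩
  rw [SimpleGraph.Walk.support_nil, List.mem_singleton] at h
  exact h ▸ p.end_mem_support

end Tracking

/-! ### Lifting walks to the direct product -/

section Lifting

variable {V W : Type*} {G : SimpleGraph V} {H : SimpleGraph W}

/-- The sequence `a, b, a, b, …`. -/
def alternate : W → W → ℕ → W
  | a, _, 0 => a
  | a, b, n + 1 => alternate b a n

theorem adj_alternate {a b : W} (h : H.Adj a b) (n : ℕ) :
    H.Adj (alternate a b n) (alternate b a n) := by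
  induction n generalizing a b with
  | zero => exact h
  | succ n ih => exact ih h.symm

theorem coloring_alternate (c : H.Coloring Bool) {a b : W} (h : H.Adj a b) (n : ℕ) :
    c (alternate a b n) = c a ↔ Even n := by
  induction n generalizing a b with
  | zero => simp [alternate]
  | succ n ih =>
    rw [Nat.even_add_one, ← ih h.symm, alternate]
    have := c.valid h
    revert this
    cases c a <;> cases c b <;> cases c (alternate b a n) <;> simp

/-- The first projection of the direct product. -/
def directProductFst (G : SimpleGraph V) (H : SimpleGraph W) : directProduct G H →g G :=
  ⟨Prod.fst, fun h => h.1⟩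

/-- The second projection of the direct product. -/
def directProductSnd (G : SimpleGraph V) (H : SimpleGraph W) : directProduct G H →g H :=
  ⟨Prod.snd, fun h => h.2⟩

theorem edist_fst_le (p q : V × W) : G.edist p.1 q.1 ≤ (directProduct G H).edist p q := by
  by_cases h : (directProduct G H).edist p q = ⊤
  · rw [h]; exact le_top
  · obtain ⟨r, hr⟩ := SimpleGraph.exists_walk_of_edist_ne_top h
    rw [← hr, ← r.length_map (directProductFst G H)]
    exact SimpleGraph.edist_le (r.map (directProductFst G H))

/-- A walk in the first factor lifts to the product by alternating along an edge of the second. -/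
theorem exists_lift {u v : V} (p : G.Walk u v) {a b : W} (h : H.Adj a b) :
    ∃ P : (directProduct G H).Walk (u, a) (v, alternate a b p.length),
      P.length = p.length ∧
      ∀ w, w ∈ P.support ↔ ∃ i ≤ p.length, w = (p.getVert i, alternate a b i) := by
  induction p generalizing a b with
  | nil =>
    refine ⟨.nil, rfl, fun w => ?_⟩
    simp [alternate]
  | @cons u u' v hu p ih =>
    obtain ⟨P, hP, hsupp⟩ := ih h.symm
    have hadj : (directProduct G H).Adj (u, a) (u', b) := ⟨hu, h⟩
    have hQ : ∀ w, w ∈ (SimpleGraph.Walk.cons hadj P).support ↔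
        ∃ i ≤ p.length + 1, w = ((SimpleGraph.Walk.cons hu p).getVert i, alternate a b i) := by
      intro w
      rw [SimpleGraph.Walk.support_cons, List.mem_cons, hsupp]
      constructor
      · rintro (rfl | ⟨i, hi, rfl⟩)
        · exact ⟨0, Nat.zero_le _, by simp [alternate]⟩
        · exact ⟨i + 1, by simpa using hi, by simp [alternate]⟩
      · rintro ⟨i, hi, rfl⟩
        cases i with
        | zero => left; simp [alternate]
        | succ i => exact Or.inr ⟨i, by simpa using hi, by simp [alternate]⟩
    exact ⟨SimpleGraph.Walk.cons hadj P, congrArg (· + 1) hP, hQ⟩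

theorem Tracks.of_lift {N : ℕ} (hN : ThinWalks (directProduct G H) N) {u v : V} (p : G.Walk u v)
    (hp : (p.length : ℕ∞) ≤ G.edist u v) {a b : W} (h : H.Adj a b) :
    Tracks (directProduct G H) N {w | ∃ i ≤ p.length, w = (p.getVert i, alternate a b i)}
      (u, a) (v, alternate a b p.length) := by
  obtain ⟨P, hP, hsupp⟩ := exists_lift p h
  refine Tracks.of_walk hN P ?_ fun w hw => (hsupp w).1 hw
  rw [hP]
  exact hp.trans (edist_fst_le _ _)

theorem Tracks.of_lift_symm {N : ℕ} (hN : ThinWalks (directProduct G H) N) {u v : V}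
    (p : G.Walk u v) (hp : (p.length : ℕ∞) ≤ G.edist u v) {a b : W} (h : H.Adj a b) :
    Tracks (directProduct G H) N {w | ∃ i ≤ p.length, w = (p.getVert i, alternate a b i)}
      (v, alternate a b p.length) (u, a) := by
  obtain ⟨P, hP, hsupp⟩ := exists_lift p h
  refine Tracks.of_walk hN P.reverse ?_ fun w hw => (hsupp w).1 (by simpa using hw)
  rw [SimpleGraph.Walk.length_reverse, hP, SimpleGraph.edist_comm]
  exact hp.trans (edist_fst_le _ _)

/-- The two vertices of the product over a vertex of a minimal cycle are joined near the cycle. -/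
theorem IsMinimalCycle.tracks {N : ℕ} (hN : ThinWalks (directProduct G H) N) {C : G.Subgraph}
    (hC : IsMinimalCycle C) {u : V} (hu : u ∈ C.verts) {a b : W} (h : H.Adj a b) :
    Tracks (directProduct G H) (3 * N) (C.verts ×ˢ Set.univ) (u, a) (u, b) := by
  -- The connection goes out to `x`, across the edge to `y`, and back to `u`. The two long legs have
  -- equal length, so this closed walk is odd and its lift ends at the other vertex above `u`.
  obtain ⟨x, y, hxy, hdist⟩ := hC.1.exists_adj_dist_eq ⟨u, hu⟩
  have hconn : C.coe.Connected := hC.1.connected.coe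
  have geod : ∀ z : C.verts, ∃ p : G.Walk u z, p.length = C.coe.dist ⟨u, hu⟩ z ∧
      (p.length : ℕ∞) ≤ G.edist u z ∧ ∀ w ∈ p.support, w ∈ C.verts := by
    intro z
    obtain ⟨q, hq⟩ := hconn.exists_walk_length_eq_dist ⟨u, hu⟩ z
    obtain ⟨p, hp, hpC⟩ : ∃ p : G.Walk u z, p.length = q.length ∧ ∀ w ∈ p.support, w ∈ C.verts := by
      refine ⟨q.map C.hom, q.length_map C.hom, fun w hw => ?_⟩
      obtain ⟨w', -, rfl⟩ := List.mem_map.1 ((q.support_map C.hom) ▸ hw)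
      exact w'.2
    -- Minimality enters here: shortest walks inside `C` are shortest in `G`, so their lifts are
    -- shortest in the product.
    refine ⟨p, hp.trans hq, le_iInf fun r => ?_, hpC⟩
    have h1 := hC.edist_coe_le_length hu z.2 r
    rwa [← (hconn.preconnected _ _).coe_dist_eq_edist, ← hq, ← hp] at h1
  obtain ⟨p, hp, hpg, hpC⟩ := geod x
  obtain ⟨q, hq, hqg, hqC⟩ := geod y
  have hlen : p.length = q.length := by rw [hp, hq, hdist]
  have hsub : ∀ {z : C.verts} (p : G.Walk u z), (∀ w ∈ p.support, w ∈ C.verts) → ∀ a b : W,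
      {w : V × W | ∃ i ≤ p.length, w = (p.getVert i, alternate a b i)} ⊆ C.verts ×ˢ Set.univ := by
    rintro z p hp a b _ ⟨i, -, rfl⟩
    exact ⟨hp _ (p.getVert_mem_support i), trivial⟩
  have t1 := (Tracks.of_lift hN p hpg h).mono le_rfl (hsub p hpC a b)
  have t3 := (Tracks.of_lift_symm hN q hqg h.symm).mono le_rfl (hsub q hqC b a)
  have hadj : (directProduct G H).Adj ((x : V), alternate a b p.length)
      ((y : V), alternate b a q.length) :=
    ⟨hxy.adj_sub, by rw [hlen]; exact adj_alternate h _⟩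
  have t2 : Tracks (directProduct G H) N (C.verts ×ˢ Set.univ) ((x : V), alternate a b p.length)
      ((y : V), alternate b a q.length) := by
    refine Tracks.of_walk hN hadj.toWalk ?_ ?_
    · rw [SimpleGraph.edist_eq_one_iff_adj.2 hadj]
      simp
    · intro w hw
      simp only [SimpleGraph.Adj.toWalk, SimpleGraph.Walk.support_cons,
        SimpleGraph.Walk.support_nil, List.mem_cons, List.not_mem_nil, or_false] at hw
      rcases hw with rfl | rfl
      · exact ⟨x.2, trivial⟩
      · exact ⟨y.2, trivial⟩
  have t := (t1.trans hN t2).trans hN (t3.mono (Nat.le_add_left _ _) subset_rfl)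
  exact t.mono (by omega) subset_rfl

theorem exists_walk_getVert_add {u v : V} (p : G.Walk u v) (i k : ℕ) (h : i + k ≤ p.length) :
    ∃ q : G.Walk (p.getVert i) (p.getVert (i + k)), q.length = k := by
  induction k with
  | zero => exact ⟨.nil, rfl⟩
  | succ k ih =>
    obtain ⟨q, hq⟩ := ih (by omega)
    exact ⟨q.concat (p.adj_getVert_succ (by omega)), by simp [hq]⟩

/-- If the two lifts of a shortest walk come close to each other, then there is a short odd closed
walk. -/
theorem exists_odd_walk_of_lifts_close (hH : H.Colorable 2) {u v : V} (p : G.Walk u v)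
    (hp : (p.length : ℕ∞) ≤ G.edist u v) {a b : W} (h : H.Adj a b) {i j k : ℕ}
    (hi : i ≤ p.length) (hj : j ≤ p.length)
    (hk : (directProduct G H).edist (p.getVert i, alternate a b i)
      (p.getVert j, alternate b a j) ≤ k) :
    ∃ q : G.Walk (p.getVert i) (p.getVert i), Odd q.length ∧ q.length ≤ 2 * k := by
  obtain ⟨c⟩ := hH
  replace c : H.Coloring Bool := SimpleGraph.recolorOfEquiv H finTwoEquiv c
  obtain ⟨r, hr⟩ := SimpleGraph.exists_walk_of_edist_ne_top
    (ne_top_of_le_ne_top (ENat.natCast_ne_top k) hk)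
  rw [← hr] at hk
  have hrk : r.length ≤ k := by exact_mod_cast hk
  -- The 2-colouring of `H` determines the parity of `r`. The lifts start with opposite colours,
  -- whence the negation.
  have hpar : Even r.length ↔ ¬ Even (i + j) := by
    have h1 := c.even_length_iff_congr (r.map (directProductSnd G H))
    rw [SimpleGraph.Walk.length_map] at h1
    rw [h1, Nat.even_add, ← coloring_alternate c h i, ← coloring_alternate c h.symm j]
    have := c.valid h
    revert this
    change _ → ((c (alternate a b i) = true ↔ c (alternate b a j) = true) ↔ _)
    cases c a <;> cases c b <;> cases c (alternate b a j) <;> cases c (alternate a b i) <;> simp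
  -- As `p` is shortest, no segment of it is longer than the distance of its ends, hence not longer
  -- than `r`.
  have hsmall : ∀ {x y : ℕ}, x ≤ y → y ≤ p.length →
      (r.length : ℕ∞) ≥ G.edist (p.getVert x) (p.getVert y) → y - x ≤ r.length := by
    intro x y hxy hy hrxy
    obtain ⟨q1, hq1⟩ : ∃ q : G.Walk u (p.getVert x), q.length ≤ x :=
      ⟨p.take x, by simp⟩
    obtain ⟨q2, hq2⟩ : ∃ q : G.Walk (p.getVert y) v, q.length = p.length - y :=
      ⟨p.drop y, by simp⟩
    have h1 : G.edist u v ≤ x + r.length + (p.length - y : ℕ) := by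
      refine (SimpleGraph.edist_triangle (v := p.getVert y)).trans (add_le_add
        ((SimpleGraph.edist_triangle (v := p.getVert x)).trans (add_le_add
          ((SimpleGraph.edist_le q1).trans (Nat.cast_le.2 hq1)) hrxy)) ?_)
      rw [← hq2]
      exact SimpleGraph.edist_le q2
    have h2 : p.length ≤ x + r.length + (p.length - y) := by exact_mod_cast hp.trans h1
    omega
  have hproj : (r.length : ℕ∞) ≥ G.edist (p.getVert i) (p.getVert j) := by
    rw [hr]
    exact edist_fst_le (p.getVert i, alternate a b i) (p.getVert j, alternate b a j)
  obtain ⟨q, hq, hqpar⟩ : ∃ q : G.Walk (p.getVert j) (p.getVert i), q.length ≤ k ∧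
      (Even q.length ↔ Even (i + j)) := by
    rcases le_total i j with hij | hij
    · obtain ⟨d, rfl⟩ := Nat.exists_eq_add_of_le hij
      obtain ⟨q, hq⟩ := exists_walk_getVert_add p i d hj
      have := hsmall hij hj hproj
      refine ⟨q.reverse, ?_, ?_⟩
      · rw [SimpleGraph.Walk.length_reverse]; omega
      · rw [SimpleGraph.Walk.length_reverse, hq]
        simp only [Nat.even_iff]; omega
    · obtain ⟨d, rfl⟩ := Nat.exists_eq_add_of_le hij
      obtain ⟨q, hq⟩ := exists_walk_getVert_add p j d hi
      rw [SimpleGraph.edist_comm] at hproj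
      have := hsmall hij hi hproj
      refine ⟨q, by omega, ?_⟩
      rw [hq]
      simp only [Nat.even_iff]; omega
  obtain ⟨r', hr'⟩ : ∃ r' : G.Walk (p.getVert i) (p.getVert j), r'.length = r.length :=
    ⟨r.map (directProductFst G H), r.length_map _⟩
  -- The projection of `r` and the segment of `p` have opposite parities and length at most `k`
  -- each.
  refine ⟨r'.append q, ?_, ?_⟩
  · rw [SimpleGraph.Walk.length_append, hr', ← Nat.not_even_iff_odd, Nat.even_add, hpar, hqpar]
    tauto
  · rw [SimpleGraph.Walk.length_append, hr']
    omega

end Lifting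

end DirectProductHyperbolicity

/-! ### The contradiction -/

open DirectProductHyperbolicity

theorem mainTheorem5 {V₁ V₂ : Type*} (G₁ : SimpleGraph V₁) (G₂ : SimpleGraph V₂)
    (hG₁ : G₁.Connected) (hG₂ : G₂.Connected)
    (hodd : ∃ C : G₁.Subgraph, DirectProductHyperbolicity.IsOddCycle C)
    (hnontrivial : Nontrivial V₂)
    (hbounded : Metric.ediam (Set.univ : Set (DirectProductHyperbolicity.Realization G₂)) < ⊤)
    (hnoodd : ¬ ∃ C : G₂.Subgraph, DirectProductHyperbolicity.IsOddCycle C)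
    (hfar : ∀ M : ℝ, 0 < M →
      ∃ C C' : G₁.Subgraph, DirectProductHyperbolicity.IsMinimalCycle C ∧
        DirectProductHyperbolicity.IsMinimalCycle C' ∧
      ∃ x ∈ DirectProductHyperbolicity.Realization.ofSubgraph C,
      ∃ y ∈ DirectProductHyperbolicity.Realization.ofSubgraph C',
      ∃ g : Set (DirectProductHyperbolicity.Realization G₁),
        DirectProductHyperbolicity.IsGeodesic g x y ∧
      ∃ u : V₁, DirectProductHyperbolicity.Realization.vertex G₁ u ∈ g ∧
        ENNReal.ofReal M ≤ Metric.infEDist (DirectProductHyperbolicity.Realization.vertex G₁ u)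
          (DirectProductHyperbolicity.minimalCycles G₁)) :
    ¬ DirectProductHyperbolicity.IsHyperbolic (DirectProductHyperbolicity.Realization
      (DirectProductHyperbolicity.directProduct G₁ G₂)) := by
  intro hyp
  obtain ⟨N, hN⟩ := hyp.exists_thin_walks
  replace hN : ThinWalks (directProduct G₁ G₂) N := hN
  obtain ⟨a₂, b₂, hab⟩ : ∃ a b, G₂.Adj a b := by
    obtain ⟨a⟩ := hG₂.nonempty
    exact ⟨a, hG₂.preconnected.exists_adj_of_nontrivial a⟩
  obtain ⟨C, C', hC, hC', x, hx, y, hy, g, hg, u, hu, hM⟩ :=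
    -- Here `5 * N` is the final tracking constant, an odd closed walk obtained from it has length
    -- at most `2 * (5 * N)`, and a minimal cycle lies within twice the square of that; the last 1
    -- makes the bound strict.
    hfar (5 * N + 2 * (2 * (5 * N)) ^ 2 + 1 : ℕ) (by positivity)
  obtain ⟨a, ha, b, hb, hd⟩ := exists_vertices_of_isGeodesic hx hy hg hu
  rw [ENNReal.ofReal_natCast] at hM
  have far : ∀ {D : G₁.Subgraph}, IsMinimalCycle D → ∀ w ∈ D.verts, ∀ m : ℕ,
      m < 5 * N + 2 * (2 * (5 * N)) ^ 2 + 1 → ¬ G₁.edist u w ≤ m := by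
    intro D hD w hw m hm hle
    have h := hM.trans (infEDist_minimalCycles_le hD hw u)
    have h' : ((5 * N + 2 * (2 * (5 * N)) ^ 2 + 1 : ℕ) : ℕ∞) ≤ G₁.edist u w := by
      exact_mod_cast h
    exact absurd (Nat.cast_le.1 (h'.trans hle)) hm.not_ge
  obtain ⟨p₁, hp₁⟩ := hG₁.exists_walk_length_eq_edist a u
  obtain ⟨p₂, hp₂⟩ := hG₁.exists_walk_length_eq_edist u b
  obtain ⟨p, hp, hpu⟩ : ∃ p : G₁.Walk a b, (p.length : ℕ∞) ≤ G₁.edist a b ∧ u ∈ p.support := by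
    refine ⟨p₁.append p₂, ?_, by simp⟩
    rw [SimpleGraph.Walk.length_append, Nat.cast_add, hp₁, hp₂]
    exact hd
  obtain ⟨j, rfl, hj⟩ := SimpleGraph.Walk.mem_support_iff_exists_getVert.1 hpu
  obtain ⟨P, hP, hsupp⟩ := exists_lift p hab
  set S : Set (V₁ × V₂) := C.verts ×ˢ Set.univ ∪ C'.verts ×ˢ Set.univ ∪
    {w | ∃ i ≤ p.length, w = (p.getVert i, alternate b₂ a₂ i)} with hS
  -- Detour between the ends of `P`: switch lifts near `C`, follow the other lift, switch back near
  -- `C'`. The two concatenations raise `3 * N` to `5 * N`.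
  have t1 : Tracks _ (3 * N) S _ _ := (hC.tracks hN ha hab).mono le_rfl
    (Set.subset_union_left.trans Set.subset_union_left)
  have t2 : Tracks _ (3 * N) S _ _ := (Tracks.of_lift hN p hp hab.symm).mono (by omega)
    Set.subset_union_right
  have t3 : Tracks _ (4 * N) S _ _ := (hC'.tracks hN hb (adj_alternate hab.symm p.length)).mono
    (by omega) (Set.subset_union_right.trans Set.subset_union_left)
  have t := (((t1.trans hN t2).mono (by omega) subset_rfl).trans hN t3).mono
    (show _ ≤ 5 * N by omega) subset_rfl
  obtain ⟨s, hs, hclose⟩ := t.2 P (by rw [hP]; exact hp.trans (edist_fst_le _ _)) _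
    ((hsupp _).2 ⟨j, hj, rfl⟩)
  have hfst := (edist_fst_le _ _).trans hclose
  rcases hs with (hs | hs) | ⟨i, hi, rfl⟩
  · exact far hC _ hs.1 _ (by omega) hfst
  · exact far hC' _ hs.1 _ (by omega) hfst
  -- The point above `u` is close to the other lift, which yields a minimal cycle too near to `u`.
  · obtain ⟨q, hqodd, hq⟩ := exists_odd_walk_of_lifts_close
      (colorable_two_of_not_exists_isOddCycle hnoodd) p hp hab hj hi hclose
    obtain ⟨D, hD, w, hw, hle⟩ := exists_isMinimalCycle_near _ q hqodd hq
    exact far hD w hw _ (by omega) hle
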